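/- Let $\Theta\subseteq\mathbb R^{d}$ be a Borel set. A generalised posterior $\tilde\Pi$ on $\Theta$ is given by a prior probability density $\pi$ on $\Theta$ and a loss $L$ (the observed data $x_{1:n}$ being fixed), with normalised Lebesgue density $\tilde\pi(\theta)\propto e^{-L(\theta)}\pi(\theta)$, $e^{-L}\pi$ being integrable on $\Theta$. Write $\operatorname{supp}(p)=\{\theta\in\Theta:p(\theta)>0\}$ for the support of a density and $s_p=\nabla\log p$ for its score, with $s_p:=0$ where $p$ is not positive. Let $\tilde\Pi_{\rm ref}$ be a reference generalised posterior with prior $\pi_{\rm ref}$ and loss $L_{\rm ref}$ bounded from below on $\Theta$, and let $\tilde\Pi^\lambda$ $(\lambda\in\Gamma)$ be candidate generalised posteriors with priors $\pi^\lambda$ and losses $L^\lambda$. Put $\Delta_\lambda(\theta)=\|s_{\tilde\pi_{\rm ref}}(\theta)-s_{\tilde\pi^\lambda}(\theta)\|_2^2$ and, for samples $\theta_1,\theta_2,\dots$ in $\Theta$ and $m\ge 1$, $$\mathrm{FD}(\tilde\Pi_{\rm ref}\|\tilde\Pi^\lambda)=\mathbb E_{\theta\sim\tilde\Pi_{\rm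 ref}}[\Delta_\lambda(\theta)],\qquad \widehat{\mathrm{FD}}_m(\tilde\Pi_{\rm ref}\|\tilde\Pi^\lambda)=\frac1m\sum_{i=1}^m\Delta_\lambda(\theta_i),$$ $$S^{\rm FD}(\Gamma)=\sup_{\lambda\in\Gamma}\mathrm{FD}(\tilde\Pi_{\rm ref}\|\tilde\Pi^\lambda)-\inf_{\lambda\in\Gamma}\mathrm{FD}(\tilde\Pi_{\rm ref}\|\tilde\Pi^\lambda),\qquad \widehat S^{\rm FD}_m(\Gamma)=\sup_{\lambda\in\Gamma}\widehat{\mathrm{FD}}_m(\tilde\Pi_{\rm ref}\|\tilde\Pi^\lambda)-\inf_{\lambda\in\Gamma}\widehat{\mathrm{FD}}_m(\tilde\Pi_{\rm ref}\|\tilde\Pi^\lambda).$$ **Assumption 1.** $\operatorname{supp}(\tilde\pi_{\rm ref})$ is an open connected subset of $\mathbb R^d$; $\pi_{\rm ref},L_{\rm ref}\in C^1(\Theta)$ and $s_{\pi_{\rm ref}},\nabla L_{\rm ref}\in L^2(\tilde\Pi_{\rm ref})$; and for every $\lambda\in\Gamma$, $\operatorname{supp}(\tilde\pi^\lambda)=\operatorname{supp}(\tilde\pi_{\rm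 ref})$, $\pi^\lambda,L^\lambda\in C^1(\Theta)$ and $s_{\pi^\lambda},\nabla L^\lambda\in L^2(\tilde\Pi_{\rm ref})$. **Assumption 2.** $(\theta_i)_{i\ge1}$ is a time-homogeneous Markov chain on $\Theta$ whose transition kernel $\kappa$ leaves $\tilde\Pi_{\rm ref}$ invariant, and there is a measurable $V:\Theta\to[e,\infty)$ such that * $\kappa$ is $V$-uniformly geometrically ergodic: $\mathbb E_{\tilde\Pi_{\rm ref}}[V]<\infty$ and there are $R<\infty$ and $r\in[0,1)$ with $\sup_{|f|\le V}|\kappa^nf(\theta)-\mathbb E_{\tilde\Pi_{\rm ref}}f|\le R\,r^n\,V(\theta)$ for all $n\ge0$ and $\theta\in\Theta$, the supremum being over measurable $f$; * $\sup_{\lambda\in\Gamma}\sup_{\theta\in\Theta}\Delta_\lambda(\theta)/\sqrt{V(\theta)}<\infty$; * the initial law integrates $V$, i.e. $\mathbb E[V(\theta_1)]<\infty$ (as is the case for a deterministic or a stationary start). **Theorem.** Suppose Assumptions 1 and 2 hold. Then there is a constant $0<C'<\infty$, independent of $m$, of $\delta$ and of $\lambda\in\Gamma$, such that for all $\lambda\in\Gamma$,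 $m\ge1$ and $\delta>0$, $$\mathbb P\left(\left|\widehat{\mathrm{FD}}_m(\tilde\Pi_{\rm ref}\|\tilde\Pi^\lambda)-\mathrm{FD}(\tilde\Pi_{\rm ref}\|\tilde\Pi^\lambda)\right|\ge\delta\right)\le\frac{C'}{m\delta^2}.$$ Furthermore, with the same $C'$, for all $m\ge1$ and $\delta>0$, with probability at least $1-\delta$, $$S^{\rm FD}(\Gamma)\le\widehat S^{\rm FD}_m(\Gamma)+\frac{2\sqrt{C'}}{\sqrt m\,\delta}.$$ -/

import Mathlib

open MeasureTheory ProbabilityTheory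
open scoped ENNReal

noncomputable section

namespace FisherSensitivity

/-- The data from which a generalised posterior on a parameter space in `ℝ^d` is built: a prior
density and a loss `θ ↦ L(θ; x_{1:n})`, the observed data `x_{1:n}` being fixed throughout. -/
structure BeliefSpec (d : ℕ) where
  prior : EuclideanSpace ℝ (Fin d) → ℝ
  loss : EuclideanSpace ℝ (Fin d) → ℝ

variable {d : ℕ}

/-- Lebesgue measure on a (measurable) subset `Θ` of `ℝ^d`, as a measure on the subtype. -/
def lebesgueOn (Θ : Set (EuclideanSpace ℝ (Fin d))) : Measure Θ :=
  Measure.comap (Subtype.val : Θ → EuclideanSpace ℝ (Fin d)) volume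

/-- The unnormalised generalised posterior density `exp (-L(θ)) π(θ)`. -/
def BeliefSpec.weight (B : BeliefSpec d) (θ : EuclideanSpace ℝ (Fin d)) : ℝ :=
  Real.exp (-B.loss θ) * B.prior θ

/-- The normalised generalised posterior density on `Θ`. -/
def BeliefSpec.density (B : BeliefSpec d) (Θ : Set (EuclideanSpace ℝ (Fin d)))
    (θ : EuclideanSpace ℝ (Fin d)) : ℝ :=
  B.weight θ / ∫ t : Θ, B.weight t ∂(lebesgueOn Θ)

/-- The distribution on `Θ` with Lebesgue density `p`. -/
def densityMeasure (Θ : Set (EuclideanSpace ℝ (Fin d))) (p : EuclideanSpace ℝ (Fin d) → ℝ) :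
    Measure Θ :=
  (lebesgueOn Θ).withDensity fun θ => ENNReal.ofReal (p θ)

/-- The generalised posterior distribution on `Θ`. -/
def BeliefSpec.posterior (B : BeliefSpec d) (Θ : Set (EuclideanSpace ℝ (Fin d))) : Measure Θ :=
  densityMeasure Θ (B.density Θ)

/-- The support of a density on `Θ`: the set of points of `Θ` at which it is positive. -/
def densitySupport (Θ : Set (EuclideanSpace ℝ (Fin d))) (p : EuclideanSpace ℝ (Fin d) → ℝ) :
    Set (EuclideanSpace ℝ (Fin d)) :=
  {θ | θ ∈ Θ ∧ 0 < p θ}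

open Classical in
/-- The score `s_p = ∇ log p` of a density, with the convention that it is zero where the density
is not positive (there `∇ log p` has no meaning). -/
def score (p : EuclideanSpace ℝ (Fin d) → ℝ) (θ : EuclideanSpace ℝ (Fin d)) :
    EuclideanSpace ℝ (Fin d) :=
  if 0 < p θ then gradient (fun t => Real.log (p t)) θ else 0

/-- The squared Euclidean distance between the scores of two densities. -/
def scoreGap (p q : EuclideanSpace ℝ (Fin d) → ℝ) (θ : EuclideanSpace ℝ (Fin d)) : ℝ :=
  ‖score p θ - score q θ‖ ^ 2

/-- The Fisher divergence `FD(p ‖ q) = E_{θ ∼ p} ‖s_p(θ) - s_q(θ)‖²` of two densities on `Θ`. -/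
def fisherDivergence (Θ : Set (EuclideanSpace ℝ (Fin d)))
    (p q : EuclideanSpace ℝ (Fin d) → ℝ) : ℝ :=
  ∫ θ : Θ, scoreGap p q θ ∂(densityMeasure Θ p)

/-- The estimator `(1/m) ∑_{i=1}^m ‖s_p(θ_i) - s_q(θ_i)‖²`; the samples `θ_1, θ_2, …` are
enumerated as `x 0, x 1, …`. -/
def fisherEstimator {Θ : Set (EuclideanSpace ℝ (Fin d))}
    (p q : EuclideanSpace ℝ (Fin d) → ℝ) (x : ℕ → Θ) (m : ℕ) : ℝ :=
  (1 / (m : ℝ)) * ∑ i ∈ Finset.range m, scoreGap p q (x i)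

/-- The global sensitivity `sup_{l ∈ Γ} ρ(l) - inf_{l ∈ Γ} ρ(l)`. -/
def globalSensitivity {Λ : Type*} (Γ : Set Λ) (ρ : Λ → ℝ) : ℝ :=
  (⨆ l : Γ, ρ l) - ⨅ l : Γ, ρ l

/-- The prior is a probability density on `Θ` and the posterior can be normalised. -/
structure BeliefSpec.IsProper (B : BeliefSpec d) (Θ : Set (EuclideanSpace ℝ (Fin d))) : Prop where
  prior_nonneg : ∀ θ ∈ Θ, 0 ≤ B.prior θ
  prior_prob : ∫⁻ θ : Θ, ENNReal.ofReal (B.prior θ) ∂(lebesgueOn Θ) = 1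
  weight_integrable : Integrable (fun θ : Θ => B.weight θ) (lebesgueOn Θ)

/-- Prior density and loss are `C¹` on `Θ`, and the prior score and the gradient of the loss are
in `L²(ν)`. -/
structure BeliefSpec.IsRegular (B : BeliefSpec d) (Θ : Set (EuclideanSpace ℝ (Fin d)))
    (ν : Measure Θ) : Prop where
  prior_contDiff : ContDiffOn ℝ 1 B.prior Θ
  loss_contDiff : ContDiffOn ℝ 1 B.loss Θ
  prior_score_memLp : MemLp (fun θ : Θ => score B.prior θ) 2 ν
  loss_gradient_memLp : MemLp (fun θ : Θ => gradient B.loss θ) 2 ν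

/-- Membership in `P_FD(Θ)`, the generalised posteriors whose Fisher divergence from the reference
posterior exists. -/
structure BeliefSpec.MemFD (B : BeliefSpec d) (Θ : Set (EuclideanSpace ℝ (Fin d)))
    (ref : BeliefSpec d) : Prop where
  proper : B.IsProper Θ
  support_eq : densitySupport Θ (B.density Θ) = densitySupport Θ (ref.density Θ)
  regular : B.IsRegular Θ (ref.posterior Θ)

/-- The standing assumption on the reference posterior and on the neighbourhood of candidate
posteriors indexed by `Γ`. -/
structure FDAssumption {Λ : Type*} (Θ : Set (EuclideanSpace ℝ (Fin d))) (ref : BeliefSpec d)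
    (cand : Λ → BeliefSpec d) (Γ : Set Λ) : Prop where
  ref_proper : ref.IsProper Θ
  ref_loss_bddBelow : ∃ c : ℝ, ∀ θ ∈ Θ, c ≤ ref.loss θ
  ref_support_open : IsOpen (densitySupport Θ (ref.density Θ))
  ref_support_connected : IsConnected (densitySupport Θ (ref.density Θ))
  ref_regular : ref.IsRegular Θ (ref.posterior Θ)
  cand_mem : ∀ l ∈ Γ, (cand l).MemFD Θ ref

/-- `V`-uniform geometric ergodicity of a Markov kernel `κ` with respect to `ν`: `ν` integrates
`V`, and there are `R < ∞` and `r < 1` with `‖κⁿ(x, ·) - ν‖_V ≤ R rⁿ V(x)` for all `n` and `x`, where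
`‖η‖_V = sup_{|f| ≤ V} |η(f)|`. -/
structure VUniformlyErgodic {S : Type*} [MeasurableSpace S] (κ : Kernel S S) (ν : Measure S)
    (V : S → ℝ) : Prop where
  integrable : Integrable V ν
  geometric : ∃ R r : ℝ, 0 ≤ r ∧ r < 1 ∧ ∀ (n : ℕ) (x : S) (f : S → ℝ), Measurable f →
    (∀ y, |f y| ≤ V y) → |∫ y, f y ∂((κ ^ n) x) - ∫ y, f y ∂ν| ≤ R * r ^ n * V x

/-- `X` is a time-homogeneous Markov chain with transition kernel `κ`: given `(X_0, …, X_n)`, the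
conditional distribution of `X_{n+1}` is `κ(X_n, ·)`. The initial law is arbitrary. -/
structure IsMarkovChain {Ω S : Type*} [MeasurableSpace Ω] [MeasurableSpace S] (κ : Kernel S S)
    (X : ℕ → Ω → S) (P : Measure Ω) : Prop where
  measurable : ∀ n, Measurable (X n)
  transition : ∀ n : ℕ, HasCondDistrib (X (n + 1)) (fun ω (i : Fin (n + 1)) => X i ω)
    (κ.comap (fun h : Fin (n + 1) → S => h (Fin.last n)) (measurable_pi_apply _)) P

/-- The assumption on the sampler: `X` is a Markov chain whose kernel leaves the reference posterior
invariant and is `V`-uniformly geometrically ergodic for the Lyapunov function `V : Θ → [e, ∞)`, the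
initial law integrates `V`, and the squared score differences grow at most like `√V`, uniformly over
`Γ`. -/
structure MCMCAssumption {Λ Ω : Type*} [MeasurableSpace Ω] (Θ : Set (EuclideanSpace ℝ (Fin d)))
    (ref : BeliefSpec d) (cand : Λ → BeliefSpec d) (Γ : Set Λ) (κ : Kernel Θ Θ) (V : Θ → ℝ)
    (X : ℕ → Ω → Θ) (P : Measure Ω) : Prop where
  invariant : κ.Invariant (ref.posterior Θ)
  chain : IsMarkovChain κ X P
  V_measurable : Measurable V
  V_ge : ∀ θ, Real.exp 1 ≤ V θ
  ergodic : VUniformlyErgodic κ (ref.posterior Θ) V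
  initial : Integrable (fun ω => V (X 0 ω)) P
  growth : ∃ K : ℝ, ∀ l ∈ Γ, ∀ θ : Θ,
    scoreGap (ref.density Θ) ((cand l).density Θ) θ / Real.sqrt (V θ) ≤ K

end FisherSensitivity

end

/-!
The estimator is an ergodic average of the score gap `Δ` along the chain, so the first claim is
Chebyshev's inequality for such averages once the second moment of `∑ (Δ(X_i) - ν Δ)` is known to be
`O(m)`, uniformly over all functions with `|Δ| ≤ K √V`. Uniformity costs nothing because every
constant depends on `Δ` only through `K`.

The correlation of `g(X_i)` and `g(X_{i+n})`, for `g = Δ - ν Δ`, is the mean of `g(X_i) (κⁿ g)(X_i)`.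
Ergodicity in the `V`-norm alone would bound this by the mean of `V ^ (3/2)`, which need not be
finite. Truncation at a suitable level (`abs_integral_sub_le_three_mul_sqrt`) turns the `V`-norm
bound `R rⁿ V` for `κⁿ(x, ·) - ν` into a `√V`-norm bound `3 √(R rⁿ V)`, so the correlation is at most
a constant times `(√r)ⁿ E[V(X_i)]`, and `E[V(X_i)]` is bounded in `i` because the initial law
integrates `V`. These bounds are `IsMarkovChain.abs_integral_mul_le` and
`IsMarkovChain.lintegral_le`; they are summed in `integral_sum_sq_le`.

For the sensitivity no uniform law of large numbers is needed, as the inequality is one-sided. With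
`l₁`, `l₂` nearly attaining the supremum and the infimum of the divergence, `FD(l₁) - FD(l₂)` exceeds
its empirical version by at most the two errors at `l₁` and `l₂`, and the empirical version is at
most the empirical range (`exists_event_globalSensitivity_le`). The extra slack in the constant pays
for the range being only nearly attained.
-/

namespace FisherSensitivity

/-! ### Consequences of `V`-uniform ergodicity -/

section Ergodic

variable {S : Type*} [MeasurableSpace S] {κ : Kernel S S} {ν : Measure S} {V : S → ℝ}

lemma isMarkovKernel_pow [IsMarkovKernel κ] (n : ℕ) : IsMarkovKernel (κ ^ n) := by
  induction n with
  | zero => exact inferInstanceAs (IsMarkovKernel Kernel.id)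
  | succ n ih =>
    rw [pow_succ]
    exact inferInstanceAs (IsMarkovKernel ((κ ^ n) ∘ₖ κ))

/-- The constants can be enlarged to be strictly positive, so that the error bound `R rⁿ V(x)` can be
divided by. -/
lemma VUniformlyErgodic.exists_pos (h : VUniformlyErgodic κ ν V) (hV : ∀ x, 1 ≤ V x) :
    ∃ R r : ℝ, 0 < R ∧ 0 < r ∧ r < 1 ∧ ∀ (n : ℕ) (x : S) (f : S → ℝ), Measurable f →
      (∀ y, |f y| ≤ V y) → |∫ y, f y ∂((κ ^ n) x) - ∫ y, f y ∂ν| ≤ R * r ^ n * V x := by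
  obtain ⟨R, r, hr0, hr1, hR⟩ := h.geometric
  refine ⟨max R 1, max r (1 / 2), by positivity, by positivity,
    max_lt hr1 (by norm_num), fun n x f hf hfV => (hR n x f hf hfV).trans ?_⟩
  have := hV x
  gcongr
  · exact le_max_left _ _
  · exact le_max_left _ _

/-- Testing the ergodicity bound on the constant function `1` identifies the total mass of the
limit. -/
lemma VUniformlyErgodic.isProbabilityMeasure [IsMarkovKernel κ] [Nonempty S]
    (h : VUniformlyErgodic κ ν V) (hV : ∀ x, 1 ≤ V x) : IsProbabilityMeasure ν := by
  obtain ⟨R, r, -, hr0, hr1, hR⟩ := h.exists_pos hV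
  obtain ⟨x⟩ := ‹Nonempty S›
  have hlim : Filter.Tendsto (fun n : ℕ => R * r ^ n * V x) Filter.atTop (nhds 0) := by
    simpa using ((tendsto_pow_atTop_nhds_zero_of_lt_one hr0.le hr1).const_mul R).mul_const (V x)
  have hle : |1 - ν.real Set.univ| ≤ 0 := by
    refine ge_of_tendsto' hlim fun n => ?_
    have := isMarkovKernel_pow (κ := κ) n
    simpa using hR n x (fun _ => 1) measurable_const (by simpa using hV)
  have h1 : ν.real Set.univ = 1 := by
    have := abs_nonpos_iff.1 hle
    linarith
  rw [measureReal_def] at h1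
  exact ⟨(ENNReal.toReal_eq_one_iff _).1 h1⟩

/-- The ergodicity bound is phrased with Bochner integrals, which vanish on non-integrable
functions, so `κⁿ V < ∞` is not immediate: it follows by monotone convergence from the bound for
the truncations `min V N`. -/
lemma lintegral_pow_le [IsMarkovKernel κ] (hVm : Measurable V) (hV : ∀ x, 1 ≤ V x)
    (hint : Integrable V ν) {n : ℕ} {x : S} {D : ℝ}
    (hD : ∀ f : S → ℝ, Measurable f → (∀ y, |f y| ≤ V y) →
      |∫ y, f y ∂((κ ^ n) x) - ∫ y, f y ∂ν| ≤ D) :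
    ∫⁻ y, ENNReal.ofReal (V y) ∂((κ ^ n) x) ≤ ENNReal.ofReal (∫ y, V y ∂ν + D) := by
  have := isMarkovKernel_pow (κ := κ) n
  have hsup : ∀ y, ENNReal.ofReal (V y) = ⨆ N : ℕ, ENNReal.ofReal (min (V y) N) := by
    intro y
    refine le_antisymm ?_ (iSup_le fun N => ENNReal.ofReal_le_ofReal (min_le_left _ _))
    obtain ⟨N, hN⟩ := exists_nat_ge (V y)
    exact le_iSup_of_le N (by rw [min_eq_left hN])
  simp_rw [hsup]
  have hmono : Monotone fun (N : ℕ) (y : S) => ENNReal.ofReal (min (V y) N) := fun N M hNM y =>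
    ENNReal.ofReal_le_ofReal (min_le_min_left _ (by exact_mod_cast hNM))
  rw [lintegral_iSup (fun N => (hVm.min measurable_const).ennreal_ofReal) hmono]
  refine iSup_le fun N => ?_
  have h0 : ∀ y, 0 ≤ min (V y) (N : ℝ) := fun y =>
    le_min (zero_le_one.trans (hV y)) (Nat.cast_nonneg N)
  have hm : Measurable fun y => min (V y) (N : ℝ) := hVm.min measurable_const
  have hbd : ∀ y, |min (V y) (N : ℝ)| ≤ V y := fun y => by
    rw [abs_of_nonneg (h0 y)]
    exact min_le_left _ _
  have hi : Integrable (fun y => min (V y) (N : ℝ)) ((κ ^ n) x) :=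
    Integrable.of_bound hm.aestronglyMeasurable (N : ℝ) (ae_of_all _ fun y => by
      rw [Real.norm_eq_abs, abs_of_nonneg (h0 y)]
      exact min_le_right _ _)
  rw [← ofReal_integral_eq_lintegral_ofReal hi (ae_of_all _ h0)]
  refine ENNReal.ofReal_le_ofReal ?_
  have h1 := (abs_le.1 (hD _ hm hbd)).2
  have h2 : ∫ y, min (V y) (N : ℝ) ∂ν ≤ ∫ y, V y ∂ν :=
    integral_mono (hint.mono' hm.aestronglyMeasurable (ae_of_all _ hbd)) hint
      fun y => min_le_left _ _
  linarith

lemma integrable_pow [IsMarkovKernel κ] (hVm : Measurable V) (hV : ∀ x, 1 ≤ V x)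
    (hint : Integrable V ν) {n : ℕ} {x : S} {D : ℝ}
    (hD : ∀ f : S → ℝ, Measurable f → (∀ y, |f y| ≤ V y) →
      |∫ y, f y ∂((κ ^ n) x) - ∫ y, f y ∂ν| ≤ D) :
    Integrable V ((κ ^ n) x) :=
  (lintegral_ofReal_ne_top_iff_integrable hVm.aestronglyMeasurable
    (ae_of_all _ fun y => zero_le_one.trans (hV y))).1
    ((lintegral_pow_le hVm hV hint hD).trans_lt ENNReal.ofReal_lt_top).ne

/-- If two probability measures are at `V`-distance at most `D`, then their `√V`-distance is at most
`3 √D`. -/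
lemma abs_integral_sub_le_three_mul_sqrt {μ ν : Measure S} [IsProbabilityMeasure μ]
    [IsProbabilityMeasure ν] (hV : ∀ x, 1 ≤ V x) (hμ : Integrable V μ) (hν : Integrable V ν)
    (hVm : Measurable V) {D : ℝ} (hD0 : 0 < D)
    (hD : ∀ f : S → ℝ, Measurable f → (∀ y, |f y| ≤ V y) → |∫ y, f y ∂μ - ∫ y, f y ∂ν| ≤ D)
    {f : S → ℝ} (hf : Measurable f) (hfV : ∀ y, |f y| ≤ Real.sqrt (V y)) :
    |∫ y, f y ∂μ - ∫ y, f y ∂ν| ≤ 3 * Real.sqrt D := by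
  -- Split `f` at the level `√V = a`, where the two error terms `2a` and `D / a` balance.
  set a := Real.sqrt D with ha
  have ha0 : 0 < a := Real.sqrt_pos.2 hD0
  have haD : a * a = D := Real.mul_self_sqrt hD0.le
  set s : Set S := {y | Real.sqrt (V y) ≤ a} with hs
  have hsm : MeasurableSet s := measurableSet_le hVm.sqrt measurable_const
  have hVV : ∀ y, Real.sqrt (V y) ≤ V y := fun y =>
    (Real.sqrt_le_left (zero_le_one.trans (hV y))).2 (by nlinarith [hV y])
  have hfi : ∀ η : Measure S, Integrable V η → Integrable f η := fun η hη =>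
    hη.mono' hf.aestronglyMeasurable (ae_of_all _ fun y => (hfV y).trans (hVV y))
  have hsplit : ∀ η : Measure S, Integrable V η →
      ∫ y, f y ∂η = ∫ y, s.indicator f y ∂η + ∫ y, sᶜ.indicator f y ∂η := fun η hη => by
    rw [integral_indicator hsm, integral_indicator hsm.compl, integral_add_compl hsm (hfi η hη)]
  have hlow : ∀ η : Measure S, IsProbabilityMeasure η → |∫ y, s.indicator f y ∂η| ≤ a := by
    intro η _
    have := norm_integral_le_of_norm_le_const (μ := η) (f := s.indicator f) (C := a)
      (ae_of_all _ fun y => by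
        by_cases hy : y ∈ s
        · simpa [hy] using (hfV y).trans hy
        · simpa [hy] using ha0.le)
    simpa using this
  have hhigh := hD (fun y => a * sᶜ.indicator f y) ((hf.indicator hsm.compl).const_mul a)
    (fun y => by
      by_cases hy : y ∈ s
      · simpa [hy] using zero_le_one.trans (hV y)
      · have hy' : a ≤ Real.sqrt (V y) := (not_le.1 hy).le
        have hsq := Real.mul_self_sqrt (zero_le_one.trans (hV y))
        simp only [Set.mem_compl_iff, hy, not_false_eq_true, Set.indicator_of_mem, abs_mul,
          abs_of_pos ha0]
        nlinarith [hfV y, abs_nonneg (f y), Real.sqrt_nonneg (V y)])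
  rw [integral_const_mul, integral_const_mul, ← mul_sub, abs_mul, abs_of_pos ha0, ← haD] at hhigh
  have hhigh' := le_of_mul_le_mul_left hhigh ha0
  have hlμ := abs_le.1 (hlow μ inferInstance)
  have hlν := abs_le.1 (hlow ν inferInstance)
  have hh := abs_le.1 hhigh'
  rw [hsplit μ hμ, hsplit ν hν, abs_le]
  constructor <;> linarith [hh.1, hh.2, hlμ.1, hlμ.2, hlν.1, hlν.2]

end Ergodic

/-! ### Multi-step transitions of a Markov chain -/

section Chain

variable {Ω S : Type*} [MeasurableSpace Ω] [MeasurableSpace S] {κ : Kernel S S}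
  {X : ℕ → Ω → S} {P : Measure Ω} {V : S → ℝ}

/-- One transition of the chain, tested against an event of the past at time `i`. -/
lemma IsMarkovChain.setLIntegral_succ [IsMarkovKernel κ] [IsProbabilityMeasure P]
    (hX : IsMarkovChain κ X P) {i j : ℕ} (hij : i ≤ j) {s : Set S} (hs : MeasurableSet s)
    {h : S → ℝ≥0∞} (hh : Measurable h) :
    ∫⁻ ω in X i ⁻¹' s, h (X (j + 1) ω) ∂P
      = ∫⁻ ω in X i ⁻¹' s, ∫⁻ y, h y ∂(κ (X j ω)) ∂P := by
  have hmeas := hX.measurable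
  have hhist : Measurable fun ω (k : Fin (j + 1)) => X k ω := measurable_pi_lambda _ fun k => hmeas k
  have hev : Measurable fun z : Fin (j + 1) → S => z ⟨i, Nat.lt_succ_of_le hij⟩ :=
    measurable_pi_apply _
  have : IsProbabilityMeasure (P.map fun ω (k : Fin (j + 1)) => X k ω) :=
    Measure.isProbabilityMeasure_map hhist.aemeasurable
  have key := congrArg (fun μ : Measure ((Fin (j + 1) → S) × S) =>
    ∫⁻ z in ((fun z : Fin (j + 1) → S => z ⟨i, Nat.lt_succ_of_le hij⟩) ⁻¹' s) ×ˢ Set.univ,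
      h z.2 ∂μ) (hX.transition j).map_eq
  simp only at key
  rw [setLIntegral_map ((hev hs).prod .univ) (by fun_prop) (hhist.prodMk (hmeas _)),
    Measure.setLIntegral_compProd (by fun_prop) (hev hs) .univ,
    setLIntegral_map (hev hs) ?_ hhist] at key
  · convert! key using 1
    · congr 2
      ext ω
      simp
    · simp [Fin.last, Set.preimage]
  · simp only [Measure.restrict_univ, Kernel.comap_apply]
    exact hh.lintegral_kernel.comp (measurable_pi_apply _)

lemma IsMarkovChain.setLIntegral_add [IsMarkovKernel κ] [IsProbabilityMeasure P]
    (hX : IsMarkovChain κ X P) (i n : ℕ) {s : Set S} (hs : MeasurableSet s)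
    {h : S → ℝ≥0∞} (hh : Measurable h) :
    ∫⁻ ω in X i ⁻¹' s, h (X (i + n) ω) ∂P
      = ∫⁻ ω in X i ⁻¹' s, ∫⁻ y, h y ∂((κ ^ n) (X i ω)) ∂P := by
  induction n generalizing h with
  | zero =>
    refine lintegral_congr fun ω => ?_
    rw [pow_zero]
    change _ = ∫⁻ y, h y ∂(Kernel.id (X i ω))
    rw [Kernel.id_apply, lintegral_dirac' _ hh, add_zero]
  | succ n ih =>
    rw [← add_assoc, hX.setLIntegral_succ (Nat.le_add_right i n) hs hh, ih hh.lintegral_kernel]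
    refine lintegral_congr fun ω => ?_
    rw [pow_succ']
    change _ = ∫⁻ y, h y ∂((κ ∘ₖ (κ ^ n)) (X i ω))
    rw [Kernel.lintegral_comp _ _ _ hh]

/-- The conditional distribution of `X_{i+n}` given `X_i` is `κⁿ(X_i, ·)`. -/
lemma IsMarkovChain.hasCondDistrib_add [IsMarkovKernel κ] [IsProbabilityMeasure P]
    (hX : IsMarkovChain κ X P) (i n : ℕ) : HasCondDistrib (X (i + n)) (X i) (κ ^ n) P where
  aemeasurable := ((hX.measurable _).prodMk (hX.measurable _)).aemeasurable
  map_eq := by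
    have := isMarkovKernel_pow (κ := κ) n
    have hm := hX.measurable
    have : IsProbabilityMeasure (P.map (X i)) :=
      Measure.isProbabilityMeasure_map (hm i).aemeasurable
    have : IsProbabilityMeasure (P.map fun ω => (X i ω, X (i + n) ω)) :=
      Measure.isProbabilityMeasure_map ((hm i).prodMk (hm _)).aemeasurable
    refine Measure.ext_prod fun {s t} hs ht => ?_
    rw [Measure.compProd_apply_prod hs ht, Measure.map_apply ((hm i).prodMk (hm _)) (hs.prod ht),
      setLIntegral_map hs (Kernel.measurable_coe _ ht) (hm i)]
    have key := hX.setLIntegral_add i n hs (measurable_const.indicator ht : Measurable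
      (t.indicator fun _ => (1 : ℝ≥0∞)))
    simp only [lintegral_indicator_one ht, ← Pi.one_def] at key
    rw [← key]
    have : (fun ω => t.indicator (1 : S → ℝ≥0∞) (X (i + n) ω))
        = (X (i + n) ⁻¹' t).indicator 1 := rfl
    rw [this, lintegral_indicator_one (hm _ ht), Measure.restrict_apply (hm _ ht), Set.inter_comm]
    rfl

end Chain

/-! ### Sums of geometrically decorrelated variables -/

section SecondMoment

variable {Ω : Type*} [MeasurableSpace Ω] {P : Measure Ω}

/-- Partial sums of square-integrable variables with geometrically decaying correlations have second
moments that grow at most linearly: adding `Y_m` to the sum of the earlier terms costs at most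
`A + 2 A (ρ + ρ² + ⋯)`. -/
lemma integral_sum_sq_le {Y : ℕ → Ω → ℝ} (hY : ∀ i, MemLp (Y i) 2 P) {A ρ : ℝ} (hρ0 : 0 ≤ ρ)
    (hρ1 : ρ < 1) (hA : 0 ≤ A) (hcov : ∀ i n, |∫ ω, Y i ω * Y (i + n) ω ∂P| ≤ A * ρ ^ n) (m : ℕ) :
    ∫ ω, (∑ i ∈ Finset.range m, Y i ω) ^ 2 ∂P ≤ m * (2 * A / (1 - ρ)) := by
  have hmul : ∀ i j, Integrable (fun ω => Y i ω * Y j ω) P := fun i j =>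
    (hY i).integrable_mul (hY j)
  induction m with
  | zero => simp
  | succ m ih =>
    have hS : MemLp (fun ω => ∑ i ∈ Finset.range m, Y i ω) 2 P := memLp_finsetSum _ fun i _ => hY i
    have hexp : ∀ ω, (∑ i ∈ Finset.range (m + 1), Y i ω) ^ 2
        = (∑ i ∈ Finset.range m, Y i ω) ^ 2
          + (2 * ∑ i ∈ Finset.range m, Y i ω * Y m ω + Y m ω * Y m ω) := fun ω => by
      rw [Finset.sum_range_succ, ← Finset.sum_mul]
      ring
    have hi2 : Integrable (fun ω => ∑ i ∈ Finset.range m, Y i ω * Y m ω) P :=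
      integrable_finsetSum _ fun i _ => hmul i m
    have hi3 : Integrable
        (fun ω => 2 * ∑ i ∈ Finset.range m, Y i ω * Y m ω + Y m ω * Y m ω) P :=
      (hi2.const_mul 2).add (hmul m m)
    simp_rw [hexp]
    rw [integral_add hS.integrable_sq hi3, integral_add (hi2.const_mul 2) (hmul m m),
      integral_const_mul, integral_finsetSum _ fun i _ => hmul i m]
    have hdiag : ∫ ω, Y m ω * Y m ω ∂P ≤ A := by
      simpa using (le_abs_self _).trans (hcov m 0)
    have hoff : ∑ i ∈ Finset.range m, ∫ ω, Y i ω * Y m ω ∂P ≤ A * (ρ / (1 - ρ)) := by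
      calc ∑ i ∈ Finset.range m, ∫ ω, Y i ω * Y m ω ∂P
          ≤ ∑ i ∈ Finset.range m, A * ρ ^ (m - i) := by
            refine Finset.sum_le_sum fun i hi => ?_
            have h := (le_abs_self _).trans (hcov i (m - i))
            rwa [Nat.add_sub_cancel' (Finset.mem_range.1 hi).le] at h
        _ = A * (ρ * ∑ k ∈ Finset.range m, ρ ^ k) := by
            rw [← Finset.sum_range_reflect (fun k => ρ ^ k), ← Finset.mul_sum, Finset.mul_sum _ _ ρ]
            congr 1
            refine Finset.sum_congr rfl fun i hi => ?_
            rw [← pow_succ']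
            congr 1
            have := Finset.mem_range.1 hi
            omega
        _ ≤ A * (ρ / (1 - ρ)) := by
            rw [div_eq_mul_inv, ← tsum_geometric_of_lt_one hρ0 hρ1]
            gcongr
            exact (summable_geometric_of_lt_one hρ0 hρ1).sum_le_tsum _ fun k _ => by positivity
    have h1 : 0 < 1 - ρ := by linarith
    have hconst : A + 2 * (A * (ρ / (1 - ρ))) ≤ 2 * A / (1 - ρ) := by
      rw [← sub_nonneg]
      have : 2 * A / (1 - ρ) - (A + 2 * (A * (ρ / (1 - ρ)))) = A := by
        field_simp
        ring
      rw [this]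
      exact hA
    push_cast
    linarith

end SecondMoment

/-! ### Quantitative law of large numbers for the chain -/

section LawOfLargeNumbers

variable {Ω S : Type*} [MeasurableSpace Ω] [MeasurableSpace S] {κ : Kernel S S} {ν : Measure S}
  {X : ℕ → Ω → S} {P : Measure Ω} {V : S → ℝ}

/-- The mean of `V` along the chain is bounded uniformly in time. -/
lemma IsMarkovChain.lintegral_le [IsMarkovKernel κ] [IsProbabilityMeasure P]
    (hX : IsMarkovChain κ X P) (hVm : Measurable V) (hV : ∀ x, 1 ≤ V x) (hν : Integrable V ν)
    (h0 : Integrable (fun ω => V (X 0 ω)) P) {R r : ℝ} (hR : 0 < R) (hr0 : 0 < r) (hr1 : r < 1)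
    (hgeo : ∀ (n : ℕ) (x : S) (f : S → ℝ), Measurable f →
      (∀ y, |f y| ≤ V y) → |∫ y, f y ∂((κ ^ n) x) - ∫ y, f y ∂ν| ≤ R * r ^ n * V x) (n : ℕ) :
    ∫⁻ ω, ENNReal.ofReal (V (X n ω)) ∂P
      ≤ ENNReal.ofReal (∫ y, V y ∂ν + R * ∫ ω, V (X 0 ω) ∂P) := by
  have hV0 : ∀ x, 0 ≤ V x := fun x => zero_le_one.trans (hV x)
  have key := hX.setLIntegral_add 0 n .univ hVm.ennreal_ofReal
  simp only [Set.preimage_univ, Measure.restrict_univ, zero_add] at key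
  rw [key]
  have hc : 0 ≤ ∫ y, V y ∂ν := integral_nonneg hV0
  calc ∫⁻ ω, ∫⁻ y, ENNReal.ofReal (V y) ∂((κ ^ n) (X 0 ω)) ∂P
      ≤ ∫⁻ ω, ENNReal.ofReal (∫ y, V y ∂ν + R * V (X 0 ω)) ∂P := by
        refine lintegral_mono fun ω => (lintegral_pow_le hVm hV hν (hgeo n (X 0 ω))).trans
          (ENNReal.ofReal_le_ofReal ?_)
        have h1 : r ^ n ≤ 1 := pow_le_one₀ hr0.le hr1.le
        have := hV0 (X 0 ω)
        gcongr
        nlinarith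
    _ = ENNReal.ofReal (∫ ω, (∫ y, V y ∂ν + R * V (X 0 ω)) ∂P) := by
        exact (ofReal_integral_eq_lintegral_ofReal ((integrable_const _).add (h0.const_mul R))
          (ae_of_all _ fun ω => add_nonneg hc (mul_nonneg hR.le (hV0 _)))).symm
    _ = ENNReal.ofReal (∫ y, V y ∂ν + R * ∫ ω, V (X 0 ω) ∂P) := by
        rw [integral_add (integrable_const _) (h0.const_mul R), integral_const_mul]
        simp

/-- Correlations of a `ν`-centred function bounded by `c √V` decay geometrically along the chain.
Conditioning on `X_i` turns the correlation into the mean of `g(X_i) (κⁿ g)(X_i)`, where each of the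
two factors is of order `√V(X_i)`. -/
lemma IsMarkovChain.abs_integral_mul_le [IsMarkovKernel κ] [IsProbabilityMeasure P]
    [IsProbabilityMeasure ν]
    (hX : IsMarkovChain κ X P) (hVm : Measurable V) (hV : ∀ x, 1 ≤ V x) (hν : Integrable V ν)
    {R r : ℝ} (hR : 0 < R) (hr0 : 0 < r)
    (hgeo : ∀ (n : ℕ) (x : S) (f : S → ℝ), Measurable f →
      (∀ y, |f y| ≤ V y) → |∫ y, f y ∂((κ ^ n) x) - ∫ y, f y ∂ν| ≤ R * r ^ n * V x)
    {B : ℝ} (hVi : ∀ n, Integrable (fun ω => V (X n ω)) P) (hB : ∀ n, ∫ ω, V (X n ω) ∂P ≤ B)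
    {g : S → ℝ} (hg : Measurable g) {c : ℝ} (hc : 0 < c) (hgV : ∀ x, |g x| ≤ c * Real.sqrt (V x))
    (hg0 : ∫ x, g x ∂ν = 0) (i n : ℕ) :
    |∫ ω, g (X i ω) * g (X (i + n) ω) ∂P| ≤ 3 * c ^ 2 * Real.sqrt R * B * Real.sqrt r ^ n := by
  have := isMarkovKernel_pow (κ := κ) n
  have hm := hX.measurable
  have hV0 : ∀ x, 0 ≤ V x := fun x => zero_le_one.trans (hV x)
  have : IsProbabilityMeasure (P.map (X i)) :=
    Measure.isProbabilityMeasure_map (hm i).aemeasurable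
  have hlaw := (hX.hasCondDistrib_add i n).map_eq
  have hpair : Measurable fun ω => (X i ω, X (i + n) ω) := (hm i).prodMk (hm _)
  have hgg : Measurable fun z : S × S => g z.1 * g z.2 := by fun_prop
  have hint : Integrable (fun ω => g (X i ω) * g (X (i + n) ω)) P := by
    refine (((hVi i).add (hVi (i + n))).const_mul (c ^ 2)).mono'
      (hgg.comp hpair).aestronglyMeasurable (ae_of_all _ fun ω => ?_)
    have h1 := hgV (X i ω)
    have h2 := hgV (X (i + n) ω)
    have s1 := Real.sq_sqrt (hV0 (X i ω))
    have s2 := Real.sq_sqrt (hV0 (X (i + n) ω))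
    rw [Real.norm_eq_abs, abs_mul]
    calc |g (X i ω)| * |g (X (i + n) ω)|
        ≤ (c * Real.sqrt (V (X i ω))) * (c * Real.sqrt (V (X (i + n) ω))) := by gcongr
      _ = c ^ 2 * (Real.sqrt (V (X i ω)) * Real.sqrt (V (X (i + n) ω))) := by ring
      _ ≤ c ^ 2 * (V (X i ω) + V (X (i + n) ω)) := by
        gcongr
        nlinarith [sq_nonneg (Real.sqrt (V (X i ω)) - Real.sqrt (V (X (i + n) ω))),
          hV0 (X i ω), hV0 (X (i + n) ω)]
  have hint' : Integrable (fun z : S × S => g z.1 * g z.2) (P.map (X i) ⊗ₘ (κ ^ n)) := by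
    rw [← hlaw]
    exact (integrable_map_measure hgg.aestronglyMeasurable hpair.aemeasurable).2 hint
  have heq : ∫ ω, g (X i ω) * g (X (i + n) ω) ∂P
      = ∫ ω, g (X i ω) * ∫ y, g y ∂((κ ^ n) (X i ω)) ∂P := by
    have h1 : ∫ ω, g (X i ω) * g (X (i + n) ω) ∂P
        = ∫ z, g z.1 * g z.2 ∂(P.map fun ω => (X i ω, X (i + n) ω)) :=
      (integral_map hpair.aemeasurable hgg.aestronglyMeasurable).symm
    rw [h1, hlaw, Measure.integral_compProd hint']
    simp only [integral_const_mul]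
    have hk : Measurable fun x => ∫ y, g y ∂((κ ^ n) x) :=
      (hg.stronglyMeasurable.integral_kernel).measurable
    exact integral_map (hm i).aemeasurable (hg.mul hk).aestronglyMeasurable
  have hsqrtpow : Real.sqrt (r ^ n) = Real.sqrt r ^ n := by
    rw [Real.sqrt_eq_iff_mul_self_eq (by positivity) (by positivity), ← mul_pow,
      Real.mul_self_sqrt hr0.le]
  have hdecay : ∀ x, |∫ y, g y ∂((κ ^ n) x)|
      ≤ 3 * c * Real.sqrt R * Real.sqrt r ^ n * Real.sqrt (V x) := fun x => by
    have hD0 : 0 < R * r ^ n * V x :=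
      mul_pos (mul_pos hR (pow_pos hr0 n)) (zero_lt_one.trans_le (hV x))
    have h := abs_integral_sub_le_three_mul_sqrt (f := fun y => c⁻¹ * g y) hV
      (integrable_pow hVm hV hν (hgeo n x)) hν hVm hD0 (hgeo n x) (hg.const_mul _) (fun y => by
        rw [abs_mul, abs_of_pos (inv_pos.2 hc), inv_mul_le_iff₀ hc]
        exact hgV y)
    rw [integral_const_mul, integral_const_mul, hg0, mul_zero, sub_zero, abs_mul,
      abs_of_pos (inv_pos.2 hc), inv_mul_le_iff₀ hc, Real.sqrt_mul (by positivity),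
      Real.sqrt_mul hR.le, hsqrtpow] at h
    linarith
  rw [heq]
  calc |∫ ω, g (X i ω) * ∫ y, g y ∂((κ ^ n) (X i ω)) ∂P|
      ≤ ∫ ω, 3 * c ^ 2 * Real.sqrt R * Real.sqrt r ^ n * V (X i ω) ∂P := by
        rw [← Real.norm_eq_abs]
        refine norm_integral_le_of_norm_le ((hVi i).const_mul _) (ae_of_all _ fun ω => ?_)
        rw [Real.norm_eq_abs, abs_mul]
        calc |g (X i ω)| * |∫ y, g y ∂((κ ^ n) (X i ω))|
            ≤ (c * Real.sqrt (V (X i ω)))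
              * (3 * c * Real.sqrt R * Real.sqrt r ^ n * Real.sqrt (V (X i ω))) := by
              gcongr
              · exact hgV _
              · exact hdecay _
          _ = 3 * c ^ 2 * Real.sqrt R * Real.sqrt r ^ n * (Real.sqrt (V (X i ω))) ^ 2 := by ring
          _ = _ := by rw [Real.sq_sqrt (hV0 _)]
    _ = 3 * c ^ 2 * Real.sqrt R * Real.sqrt r ^ n * ∫ ω, V (X i ω) ∂P := integral_const_mul _ _
    _ ≤ 3 * c ^ 2 * Real.sqrt R * Real.sqrt r ^ n * B := by
        gcongr
        exact hB i
    _ = _ := by ring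

/-- A Chebyshev bound for ergodic averages, uniform over all functions of growth at most `K √V`. -/
lemma IsMarkovChain.exists_tail_bound [IsMarkovKernel κ] [IsProbabilityMeasure P]
    (hX : IsMarkovChain κ X P) (hVm : Measurable V) (hV : ∀ x, 1 ≤ V x)
    (h : VUniformlyErgodic κ ν V) (h0 : Integrable (fun ω => V (X 0 ω)) P) (K : ℝ) :
    ∃ C : ℝ, 0 < C ∧ ∀ f : S → ℝ, Measurable f → (∀ x, |f x| ≤ K * Real.sqrt (V x)) →
      ∀ m : ℕ, 1 ≤ m → ∀ δ : ℝ, 0 < δ →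
        P {ω | δ ≤ |(1 / (m : ℝ)) * ∑ i ∈ Finset.range m, f (X i ω) - ∫ x, f x ∂ν|}
          ≤ ENNReal.ofReal (C / (m * δ ^ 2)) := by
  have hm := hX.measurable
  have hV0 : ∀ x, 0 ≤ V x := fun x => zero_le_one.trans (hV x)
  have : Nonempty Ω := nonempty_of_isProbabilityMeasure P
  have : Nonempty S := ‹Nonempty Ω›.map (X 0)
  have : IsProbabilityMeasure ν := h.isProbabilityMeasure hV
  have hν := h.integrable
  obtain ⟨R, r, hR, hr0, hr1, hgeo⟩ := h.exists_pos hV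
  set v := ∫ x, V x ∂ν with hv
  have hv0 : 0 ≤ v := integral_nonneg hV0
  set B := v + R * ∫ ω, V (X 0 ω) ∂P with hBdef
  have hB0 : 0 ≤ B := add_nonneg hv0 (mul_nonneg hR.le (integral_nonneg fun ω => hV0 _))
  have hlint := hX.lintegral_le hVm hV hν h0 hR hr0 hr1 hgeo
  have hVi : ∀ n, Integrable (fun ω => V (X n ω)) P := fun n =>
    (lintegral_ofReal_ne_top_iff_integrable (hVm.comp (hm n)).aestronglyMeasurable
      (ae_of_all _ fun ω => hV0 _)).1 ((hlint n).trans_lt ENNReal.ofReal_lt_top).ne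
  have hB : ∀ n, ∫ ω, V (X n ω) ∂P ≤ B := fun n => by
    rw [← ENNReal.ofReal_le_ofReal_iff hB0,
      ofReal_integral_eq_lintegral_ofReal (hVi n) (ae_of_all _ fun ω => hV0 _)]
    exact hlint n
  -- The centred functions `f - ν f` are bounded by `c √V`.
  set c := (|K| + 1) * (1 + v) with hcdef
  have hc : 0 < c := by positivity
  have hρ1 : Real.sqrt r < 1 := (Real.sqrt_lt' one_pos).2 (by simpa using hr1)
  set A := 3 * c ^ 2 * Real.sqrt R * B with hAdef
  have hA : 0 ≤ A := by positivity
  have h1ρ : 0 < 1 - Real.sqrt r := by linarith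
  refine ⟨2 * A / (1 - Real.sqrt r) + 1, by positivity, fun f hf hfV m hm1 δ hδ => ?_⟩
  set a := ∫ x, f x ∂ν with ha
  have hsqrt1 : ∀ x, 1 ≤ Real.sqrt (V x) := fun x => Real.one_le_sqrt.2 (hV x)
  have hsqrtV : ∀ x, Real.sqrt (V x) ≤ V x := fun x => by
    nlinarith [Real.mul_self_sqrt (hV0 x), hsqrt1 x]
  have hfV' : ∀ x, |f x| ≤ (|K| + 1) * Real.sqrt (V x) := fun x => (hfV x).trans
    (mul_le_mul_of_nonneg_right (by linarith [le_abs_self K]) (Real.sqrt_nonneg _))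
  have hfV2 : ∀ x, ‖f x‖ ≤ (|K| + 1) * V x := fun x => (hfV' x).trans
    (mul_le_mul_of_nonneg_left (hsqrtV x) (by positivity))
  have hfν : Integrable f ν :=
    (hν.const_mul (|K| + 1)).mono' hf.aestronglyMeasurable (ae_of_all _ hfV2)
  have haV : |a| ≤ (|K| + 1) * v := by
    rw [hv, ← integral_const_mul]
    exact norm_integral_le_of_norm_le (hν.const_mul _) (ae_of_all _ hfV2)
  have hg : Measurable fun x => f x - a := hf.sub_const a
  have hgV : ∀ x, |f x - a| ≤ c * Real.sqrt (V x) := fun x => by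
    have h1 := abs_sub (f x) a
    have h2 : (|K| + 1) * v ≤ (|K| + 1) * v * Real.sqrt (V x) :=
      le_mul_of_one_le_right (by positivity) (hsqrt1 x)
    calc |f x - a| ≤ |f x| + |a| := h1
      _ ≤ (|K| + 1) * Real.sqrt (V x) + (|K| + 1) * v * Real.sqrt (V x) := by
        linarith [hfV' x]
      _ = c * Real.sqrt (V x) := by rw [hcdef]; ring
  have hg0 : ∫ x, (f x - a) ∂ν = 0 := by
    rw [integral_sub hfν (integrable_const _)]
    simp [ha]
  have hL2 : ∀ i, MemLp (fun ω => f (X i ω) - a) 2 P := fun i => by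
    refine (memLp_two_iff_integrable_sq (hg.comp (hm i)).aestronglyMeasurable).2
      (((hVi i).const_mul (c ^ 2)).mono' ((hg.comp (hm i)).pow_const 2).aestronglyMeasurable
        (ae_of_all _ fun ω => ?_))
    rw [Real.norm_eq_abs, abs_of_nonneg (sq_nonneg _), ← sq_abs, ← Real.sq_sqrt (hV0 (X i ω)),
      ← mul_pow]
    exact pow_le_pow_left₀ (abs_nonneg _) (hgV _) 2
  have hmom := integral_sum_sq_le hL2 (Real.sqrt_nonneg r) hρ1 hA
    (hX.abs_integral_mul_le hVm hV hν hR hr0 hgeo hVi hB hg hc hgV hg0) m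
  have hm0 : (0 : ℝ) < m := by exact_mod_cast hm1
  -- Chebyshev is applied to the unnormalised sum, at the level `(m δ)²`.
  have hset : {ω | δ ≤ |(1 / (m : ℝ)) * ∑ i ∈ Finset.range m, f (X i ω) - a|}
      = {ω | (m * δ) ^ 2 ≤ (∑ i ∈ Finset.range m, (f (X i ω) - a)) ^ 2} := by
    ext ω
    have : (1 / (m : ℝ)) * ∑ i ∈ Finset.range m, f (X i ω) - a
        = (∑ i ∈ Finset.range m, (f (X i ω) - a)) / m := by
      rw [Finset.sum_sub_distrib]
      simp
      field_simp
    rw [Set.mem_ofPred_eq, Set.mem_ofPred_eq, this, abs_div, abs_of_pos hm0, le_div_iff₀ hm0,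
      mul_comm δ, ← sq_abs (∑ i ∈ Finset.range m, (f (X i ω) - a)),
      pow_le_pow_iff_left₀ (by positivity) (abs_nonneg _) two_ne_zero]
  have hcheb := mul_meas_ge_le_integral_of_nonneg
    (ae_of_all P fun ω => sq_nonneg (∑ i ∈ Finset.range m, (f (X i ω) - a)))
    (memLp_finsetSum (Finset.range m) fun i _ => hL2 i).integrable_sq ((m * δ) ^ 2)
  rw [hset, ← ENNReal.ofReal_toReal (measure_ne_top P _)]
  refine ENNReal.ofReal_le_ofReal ?_
  rw [le_div_iff₀ (by positivity)]
  have hle := hcheb.trans hmom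
  rw [measureReal_def] at hle
  refine le_of_mul_le_mul_left ?_ hm0
  nlinarith

end LawOfLargeNumbers

/-! ### From pointwise tail bounds to the sensitivity -/

section Sensitivity

/-- A pointwise Chebyshev bound controls the range `sup - inf` from above on a single event, without
uniform convergence over `Γ`: the bound is used only at two indices that almost attain the supremum
and the infimum of `ρ`. Boundedness of `ρ` itself is not needed: the supremum of an unbounded family of reals
is `0` by convention, and it is still exceeded up to any positive slack. -/
lemma exists_event_globalSensitivity_le {Λ Ω : Type*} [MeasurableSpace Ω] {P : Measure Ω}
    [IsProbabilityMeasure P] {Γ : Set Λ} {ρ : Λ → ℝ} {ρhat : Ω → Λ → ℝ} {C m δ : ℝ}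
    (hC : 0 < C) (hm : 0 < m) (hδ : 0 < δ)
    (hmeas : ∀ l ∈ Γ, Measurable fun ω => ρhat ω l)
    (hρhata : ∀ ω, BddAbove (Set.range fun l : Γ => ρhat ω l))
    (hρhatb : ∀ ω, BddBelow (Set.range fun l : Γ => ρhat ω l))
    (htail : ∀ l ∈ Γ, ∀ ε : ℝ, 0 < ε →
      P {ω | ε ≤ |ρhat ω l - ρ l|} ≤ ENNReal.ofReal (C / (m * ε ^ 2))) :
    ∃ A : Set Ω, MeasurableSet A ∧ 1 - ENNReal.ofReal δ ≤ P A ∧ ∀ ω ∈ A,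
      globalSensitivity Γ ρ ≤ globalSensitivity Γ (ρhat ω)
        + 2 * Real.sqrt (8 * C) / (Real.sqrt m * δ) := by
  rcases le_or_gt 1 δ with hδ1 | hδ1
  · refine ⟨∅, .empty, ?_, fun ω hω => hω.elim⟩
    rw [tsub_eq_zero_of_le (ENNReal.one_le_ofReal.2 hδ1)]
    exact zero_le
  rcases isEmpty_or_nonempty Γ with hΓ | hΓ
  · refine ⟨Set.univ, .univ, by simp, fun ω _ => ?_⟩
    simp only [globalSensitivity, Real.iSup_of_isEmpty, Real.iInf_of_isEmpty, sub_zero, zero_add]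
    positivity
  -- The allowed excess is `2t`: half of it covers the near-attainment of the supremum and the infimum
  -- (`t / 2` each), the other half the two estimation errors. At error level `t / 2` the union bound
  -- gives failure probability `δ ^ 2`, which is at most `δ`.
  set t := Real.sqrt (8 * C) / (Real.sqrt m * δ) with ht
  have ht0 : 0 < t := by positivity
  have htsq : m * t ^ 2 * δ ^ 2 = 8 * C := by
    rw [ht, div_pow, mul_pow, Real.sq_sqrt hm.le, Real.sq_sqrt (by positivity)]
    field_simp
  obtain ⟨l₁, hl₁⟩ := exists_lt_of_lt_ciSup (f := fun l : Γ => ρ l)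
    (sub_lt_self _ (half_pos ht0))
  obtain ⟨l₂, hl₂⟩ := exists_lt_of_ciInf_lt (f := fun l : Γ => ρ l)
    (lt_add_of_pos_right _ (half_pos ht0))
  have hbad : ∀ l : Γ, P {ω | t / 2 ≤ |ρhat ω l - ρ l|} ≤ ENNReal.ofReal (δ / 2) := fun l => by
    refine (htail l l.2 (t / 2) (half_pos ht0)).trans (ENNReal.ofReal_le_ofReal ?_)
    rw [div_le_iff₀ (by positivity)]
    have h1 : δ * (m * t ^ 2) * δ = 8 * C := by rw [← htsq]; ring
    have h2 : δ * (m * t ^ 2) * δ ≤ δ * (m * t ^ 2) * 1 := by gcongr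
    linarith
  have hbm : ∀ l : Γ, MeasurableSet {ω | t / 2 ≤ |ρhat ω l - ρ l|} := fun l =>
    measurableSet_le measurable_const ((hmeas l l.2).sub_const _).abs
  refine ⟨({ω | t / 2 ≤ |ρhat ω l₁ - ρ l₁|} ∪ {ω | t / 2 ≤ |ρhat ω l₂ - ρ l₂|})ᶜ,
    ((hbm l₁).union (hbm l₂)).compl, ?_, fun ω hω => ?_⟩
  · rw [prob_compl_eq_one_sub ((hbm l₁).union (hbm l₂))]
    refine tsub_le_tsub_left ((measure_union_le _ _).trans ((add_le_add (hbad l₁) (hbad l₂)).trans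
      ?_)) _
    rw [← ENNReal.ofReal_add (by positivity) (by positivity), add_halves]
  · simp only [Set.mem_compl_iff, Set.mem_union, Set.mem_ofPred_eq, not_or, not_le, abs_lt] at hω
    have h1 := le_ciSup (hρhata ω) l₁
    have h2 := ciInf_le (hρhatb ω) l₂
    have h3 : 2 * Real.sqrt (8 * C) / (Real.sqrt m * δ) = 2 * t := by rw [ht, mul_div_assoc]
    rw [h3]
    unfold globalSensitivity
    linarith [hω.1.1, hω.2.2]

end Sensitivity

/-! ### Measurability of the score gap -/

section Score

variable {d : ℕ} {Θ : Set (EuclideanSpace ℝ (Fin d))}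

lemma scoreGap_nonneg (p q : EuclideanSpace ℝ (Fin d) → ℝ) (θ : EuclideanSpace ℝ (Fin d)) :
    0 ≤ scoreGap p q θ := sq_nonneg _

/-- No regularity of the density is needed, since the derivative of an arbitrary function is Borel
measurable. -/
lemma measurable_score {p : EuclideanSpace ℝ (Fin d) → ℝ}
    (hp : MeasurableSet (densitySupport Θ p)) : Measurable fun θ : Θ => score p θ := by
  classical
  have hgrad : Measurable fun θ => gradient (fun t => Real.log (p t)) θ :=
    (InnerProductSpace.toDual ℝ (EuclideanSpace ℝ (Fin d))).symm.continuous.measurable.comp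
      (measurable_fderiv ℝ _)
  have hset : MeasurableSet {θ : Θ | 0 < p θ} := by
    convert! measurable_subtype_coe hp using 1
    ext θ
    simp [densitySupport]
  exact Measurable.ite hset (hgrad.comp measurable_subtype_coe) measurable_const

lemma measurable_scoreGap {p q : EuclideanSpace ℝ (Fin d) → ℝ}
    (hp : MeasurableSet (densitySupport Θ p)) (hq : MeasurableSet (densitySupport Θ q)) :
    Measurable fun θ : Θ => scoreGap p q θ :=
  ((measurable_score hp).sub (measurable_score hq)).norm.pow_const 2

end Score

end FisherSensitivity

open FisherSensitivity in
theorem mainTheorem2 {d : ℕ} {Λ Ω : Type*} [MeasurableSpace Ω]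
    (Θ : Set (EuclideanSpace ℝ (Fin d))) (hΘ : MeasurableSet Θ)
    (ref : BeliefSpec d) (cand : Λ → BeliefSpec d) (Γ : Set Λ)
    (κ : Kernel Θ Θ) [IsMarkovKernel κ] (V : Θ → ℝ)
    (P : Measure Ω) [IsProbabilityMeasure P] (X : ℕ → Ω → Θ)
    (hFD : FDAssumption Θ ref cand Γ)
    (hMCMC : MCMCAssumption Θ ref cand Γ κ V X P) :
    ∃ C : ℝ, 0 < C ∧
      (∀ l ∈ Γ, ∀ m : ℕ, 1 ≤ m → ∀ δ : ℝ, 0 < δ →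
        P {ω | δ ≤ |fisherEstimator (ref.density Θ) ((cand l).density Θ) (fun i => X i ω) m
              - fisherDivergence Θ (ref.density Θ) ((cand l).density Θ)|}
          ≤ ENNReal.ofReal (C / (m * δ ^ 2))) ∧
      (∀ m : ℕ, 1 ≤ m → ∀ δ : ℝ, 0 < δ →
        ∃ A : Set Ω, MeasurableSet A ∧ 1 - ENNReal.ofReal δ ≤ P A ∧ ∀ ω ∈ A,
          globalSensitivity Γ
              (fun l => fisherDivergence Θ (ref.density Θ) ((cand l).density Θ))
            ≤ globalSensitivity Γ
                (fun l => fisherEstimator (ref.density Θ) ((cand l).density Θ)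
                  (fun i => X i ω) m)
              + 2 * Real.sqrt C / (Real.sqrt m * δ)) := by
  have hV : ∀ θ, 1 ≤ V θ := fun θ => (Real.one_le_exp zero_le_one).trans (hMCMC.V_ge θ)
  obtain ⟨K, hK⟩ := hMCMC.growth
  obtain ⟨C, hC, htail⟩ := hMCMC.chain.exists_tail_bound hMCMC.V_measurable hV hMCMC.ergodic
    hMCMC.initial K
  have hgapm : ∀ l ∈ Γ,
      Measurable fun θ : Θ => scoreGap (ref.density Θ) ((cand l).density Θ) θ := fun l hl =>
    measurable_scoreGap hFD.ref_support_open.measurableSet (by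
      rw [(hFD.cand_mem l hl).support_eq]
      exact hFD.ref_support_open.measurableSet)
  have hgap : ∀ l ∈ Γ, ∀ θ : Θ,
      scoreGap (ref.density Θ) ((cand l).density Θ) θ ≤ K * Real.sqrt (V θ) := fun l hl θ =>
    (div_le_iff₀ (Real.sqrt_pos.2 (zero_lt_one.trans_le (hV θ)))).1 (hK l hl θ)
  have htail' : ∀ l ∈ Γ, ∀ m : ℕ, 1 ≤ m → ∀ δ : ℝ, 0 < δ →
      P {ω | δ ≤ |fisherEstimator (ref.density Θ) ((cand l).density Θ) (fun i => X i ω) m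
            - fisherDivergence Θ (ref.density Θ) ((cand l).density Θ)|}
        ≤ ENNReal.ofReal (C / (m * δ ^ 2)) := fun l hl =>
    htail (fun θ : Θ => scoreGap (ref.density Θ) ((cand l).density Θ) θ) (hgapm l hl) fun θ => by
      rw [abs_of_nonneg (scoreGap_nonneg _ _ _)]
      exact hgap l hl θ
  -- The factor `8` absorbs the union bound over two indices and the slack left for nearly attaining
  -- the supremum and the infimum.
  refine ⟨8 * C, by positivity, fun l hl m hm δ hδ => (htail' l hl m hm δ hδ).trans
    (ENNReal.ofReal_le_ofReal ?_), fun m hm δ hδ => ?_⟩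
  · gcongr
    linarith
  · refine exists_event_globalSensitivity_le
      (ρhat := fun ω l => fisherEstimator (ref.density Θ) ((cand l).density Θ)
        (fun i => X i ω) m) hC (by exact_mod_cast hm) hδ (fun l hl => ?_) (fun ω => ?_)
      (fun ω => ?_) (fun l hl => htail' l hl m hm)
    · simp only [fisherEstimator]
      exact (Finset.measurable_sum _ fun i _ =>
        (hgapm l hl).comp (hMCMC.chain.measurable i)).const_mul _
    · refine ⟨(1 / (m : ℝ)) * ∑ i ∈ Finset.range m, K * Real.sqrt (V (X i ω)), ?_⟩
      rintro _ ⟨l, rfl⟩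
      simp only [fisherEstimator]
      exact mul_le_mul_of_nonneg_left (Finset.sum_le_sum fun i _ => hgap l l.2 _) (by positivity)
    · refine ⟨0, ?_⟩
      rintro _ ⟨l, rfl⟩
      simp only [fisherEstimator]
      exact mul_nonneg (by positivity) (Finset.sum_nonneg fun i _ => scoreGap_nonneg _ _ _)
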